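/- For $xy\in\{00,01,10,11\}$ let $|\alpha_{xy}\rangle\in\mathbb C^2$ be given by $|\alpha_{00}\rangle=|0\rangle$, $|\alpha_{11}\rangle=|1\rangle$, $|\alpha_{01}\rangle=\frac1{\sqrt2}(|0\rangle+|1\rangle)$, $|\alpha_{10}\rangle=\frac1{\sqrt2}(|0\rangle-|1\rangle)$. For positive integers $n$ and integers $0\le\nu\le n$, let $E:\{0,1\}^{\nu}\to\{00,01,10,11\}^n$ be a random map whose values $E(u)$, $u\in\{0,1\}^\nu$, are independent and uniformly distributed, and put $|E(u)\rangle=\bigotimes_{a=1}^n|\alpha_{E(u)_a}\rangle$. A 1-pass LOCC strategy with $q$-outcome measurements on $n$ qubits consists of $n$ steps: at step $a$, given the previous outcomes $z_{<a}=(z_1,\dots,z_{a-1})\in[q]^{a-1}$, it chooses a qubit $Q_a(z_{<a})\in[n]$ that has not been measured before and measures it with a POVM $(M_a(z_{<a},\zeta))_{\zeta\in[q]}$ on $\mathbb C^2$ (some of whose elements may be zero), obtaining the outcome $z_a$. On the $n$-qubit system this is the POVM with elements $M(z)=\bigotimes_{a=1}^n M_a(z_{\le a})$, $z\in[q]^n$,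 where $M_a(z_{\le a}):=M_a(z_{<a},z_a)$ acts on qubit $Q_a(z_{<a})$. For a given $E$, let $U$ be uniform on $\{0,1\}^\nu$ and let $Z$ be the output of the strategy on the state $|E(U)\rangle$, so that $\Pr[Z=z\mid U=u]=\langle E(u)|M(z)|E(u)\rangle$. Let $I(Z;U)=H(Z)-H(Z|U)$ be the Shannon mutual information, with logarithms to base 2. **Theorem.** For every integer $c\ge0$ there are constants $\gamma>0$ and $C_1,C_2\in\mathbb R$, depending only on $c$, such that for all integers $n\ge1$, $q\ge1$ and $\nu$ with $0\le\nu$ and $n-c\le\nu\le n$, the following holds with probability at least $1-e^{-\gamma n}$ over the choice of $E$: every 1-pass LOCC strategy with $q$-outcome measurements on $n$ qubits satisfies $$I(Z;U)\le 0.7067\,n+C_1+C_2\lg(qn).$$ -/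

import Mathlib

open MeasureTheory ProbabilityTheory
open scoped ComplexOrder

namespace IsolatedQubits

noncomputable section

/-! ### Entropy of finitely supported distributions (base-2 logarithms) -/

/-- The Shannon entropy `H(p) = -∑ₓ p(x) lg p(x)` of a distribution on a finite type. -/
def shannonEntropy {α : Type*} [Fintype α] (p : α → ℝ) : ℝ :=
  -∑ x, p x * Real.logb 2 (p x)

/-- For a joint distribution `p x y = Pr[X = x, Y = y]`, the conditional entropy
`H(X|Y) = ∑_y Pr[Y = y] H(X | Y = y)`.
(Values `y` of probability zero have weight zero.) -/
def conditionalEntropy {α β : Type*} [Fintype α] [Fintype β] (p : α → β → ℝ) : ℝ :=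
  ∑ y, (∑ x, p x y) * shannonEntropy (fun x => p x y / ∑ x', p x' y)

/-- The mutual information `I(X;Y) = H(X) - H(X|Y)` of the pair with joint distribution `p`. -/
def mutualInformation {α β : Type*} [Fintype α] [Fintype β] (p : α → β → ℝ) : ℝ :=
  shannonEntropy (fun x => ∑ y, p x y) - conditionalEntropy p

/-! ### Qubits and product states -/

/-- A vector of `n` qubits, in the computational basis `{0,1}ⁿ`. -/
abbrev QubitVec (n : ℕ) : Type := (Fin n → Fin 2) → ℂ

/-- The tensor product `⊗ₐ ψₐ` of `n` single-qubit vectors. -/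
def tensorVec {n : ℕ} (ψ : Fin n → Fin 2 → ℂ) : QubitVec n :=
  fun x => ∏ a, ψ a (x a)

/-- The four single-qubit states
`α₀₀ = |0⟩`, `α₁₁ = |1⟩`, `α₀₁ = |+⟩`, `α₁₀ = |-⟩`. -/
def alpha : Bool × Bool → Fin 2 → ℂ
  | (false, false) => ![1, 0]
  | (true, true) => ![0, 1]
  | (false, true) => ![1 / (Real.sqrt 2 : ℂ), 1 / (Real.sqrt 2 : ℂ)]
  | (true, false) => ![1 / (Real.sqrt 2 : ℂ), -(1 / (Real.sqrt 2 : ℂ))]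

/-! ### The random data-hiding states -/

/-- A map `E : {0,1}^ν → {00,01,10,11}ⁿ`. -/
abbrev Encoding (ν n : ℕ) : Type := (Fin ν → Bool) → Fin n → Bool × Bool

/-- The law of the random map `E`: the values `E(u)`, for `u ∈ {0,1}^ν`, are chosen independently
and uniformly at random in `{00,01,10,11}ⁿ`. -/
def randomEncoding (ν n : ℕ) : Measure (Encoding ν n) :=
  Measure.pi fun _ : Fin ν → Bool => uniformOn (Set.univ : Set (Fin n → Bool × Bool))

/-- The state `|E(u)⟩ = ⊗ₐ |α_{E(u)ₐ}⟩`. -/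
def dataHidingState {ν n : ℕ} (E : Encoding ν n) (u : Fin ν → Bool) : QubitVec n :=
  tensorVec fun a => alpha (E u a)

/-! ### One-pass LOCC strategies -/

/-- The outcomes `z_{<a}` of the steps that come before step `a`. -/
def before {n q : ℕ} (z : Fin n → Fin q) (a : Fin n) : Fin (a : ℕ) → Fin q :=
  fun i => z ⟨i, i.isLt.trans a.isLt⟩

/-- An adaptive one-pass LOCC strategy on `n` isolated qubits with `q`-outcome measurements.
It has `n` steps. At step `a`, given the earlier outcomes `w = z_{<a}`, it measures the qubit
`qubit a w` by the POVM `povm a w 0, …, povm a w (q - 1)`. (A measurement with fewer than `q`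
outcomes has some elements equal to zero; leaving a qubit alone is the trivial measurement.) -/
structure OnePassStrategy (n q : ℕ) where
  /-- The qubit `Q_a(z_{<a})` that is measured at step `a`. -/
  qubit : (a : Fin n) → (Fin (a : ℕ) → Fin q) → Fin n
  /-- The POVM elements `M_a(z_{<a}, ζ)`. -/
  povm : (a : Fin n) → (Fin (a : ℕ) → Fin q) → Fin q → Matrix (Fin 2) (Fin 2) ℂ
  /-- POVM elements are positive semidefinite. -/
  povm_posSemidef : ∀ a w ζ, (povm a w ζ).PosSemidef
  /-- POVM elements sum to the identity. -/
  povm_sum : ∀ a w, ∑ ζ, povm a w ζ = 1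
  /-- No qubit is measured twice. -/
  qubit_injective : ∀ z : Fin n → Fin q, Function.Injective fun a => qubit a (before z a)

namespace OnePassStrategy

variable {ν n q : ℕ}

/-- The `n`-qubit POVM element `M(z) = ⊗ₐ M_a(z_{≤a})`, where `M_a(z_{≤a})` acts on the qubit
`Q_a(z_{<a})`. -/
def element (S : OnePassStrategy n q) (z : Fin n → Fin q) :
    Matrix (Fin n → Fin 2) (Fin n → Fin 2) ℂ :=
  Matrix.of fun x y =>
    ∏ a, S.povm a (before z a) (z a) (x (S.qubit a (before z a))) (y (S.qubit a (before z a)))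

/-- The Born rule: the probability `⟨ψ| M(z) |ψ⟩` of the outcome string `z` in the state `ψ`. -/
def outcomeProb (S : OnePassStrategy n q) (ψ : QubitVec n) (z : Fin n → Fin q) : ℝ :=
  (star ψ ⬝ᵥ (S.element z).mulVec ψ).re

/-- The joint distribution of `(Z, U)` in the state discrimination game: `U` is uniform on
`{0,1}^ν`, and `Z` is the output of the strategy on the state `|E(U)⟩`. -/
def gameDist (S : OnePassStrategy n q) (E : Encoding ν n)
    (z : Fin n → Fin q) (u : Fin ν → Bool) : ℝ :=
  (1 / 2 ^ ν) * S.outcomeProb (dataHidingState E u) z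

/-- The mutual information `I(Z;U)` in the state discrimination game. -/
def gameInfo (S : OnePassStrategy n q) (E : Encoding ν n) : ℝ :=
  mutualInformation (S.gameDist E)

end OnePassStrategy

end

end IsolatedQubits

/-!
The mutual information of `U` with any output `Z` is at most the relative entropy of `(Z, U)` with
respect to `Q × (law of U)` for an arbitrary distribution `Q` of `Z`. Take for `Q` the output
distribution on the maximally mixed state. Then
`I(Z;U) ≤ ∑ z, Q(z) 2^{-ν} ∑ u, G_z(E(u)) lg G_z(E(u))`, where the likelihood ratio `G_z` is a
product over the qubits of the factors `2 ⟨α_y| ρᵢ |α_y⟩`, and `ρᵢ` is the tensor factor of `M(z)` on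
qubit `i`, normalised to trace one (`OnePassStrategy.gameInfo_le`). The factors depend only on two
components `x, y` of the Bloch vector of `ρᵢ`, with `x² + y² ≤ 1`, and take the values
`1 ± x`, `1 ± y`. So the strategy enters only through a point of a product of `n` disks, the same
space for all strategies and all `q`.

On a uniformly random code word `G` has mean `1` and second moment at most `(3/2)^n`, which is
exponentially smaller than `K = 2^{0.7 n}`. Hence almost all of the mass of `G` survives truncation
at `K`, and by a Chernoff bound for the lower tail (`measureReal_average_le`) the truncated mass
`2^{-ν} ∑ u, min(G(E(u)), K)` falls below `1 - 0.02` only with doubly exponentially small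
probability. As `G` is Lipschitz with an exponential constant, a grid with `2^{O(n²)}` points
suffices to make this uniform over all product operators
(`measureReal_exists_truncatedMass_lt`).

Upper tails need no control: since `∑ z, Q(z) 2^{-ν} ∑ u, G_z(E(u)) = 1` holds exactly, a lower bound
`1 - δ` on every truncated mass leaves at most `δ` of total probability for the excess over `K`.
The truncated part contributes at most `lg K = 0.7 n` and the excess at most about `0.3 δ n` more
(`OnePassStrategy.gameInfo_le_of_truncatedMass`).
-/

namespace IsolatedQubits

/-! ### Mutual information against a reference distribution -/

/-- Gibbs' inequality, one term: `r lg Q - r lg r ≤ (Q - r) / ln 2`. -/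
lemma mul_logb_sub_mul_logb_le {r Q : ℝ} (hr : 0 ≤ r) (hQ : 0 ≤ Q) (h : Q = 0 → r = 0) :
    r * Real.logb 2 Q - r * Real.logb 2 r ≤ (Q - r) / Real.log 2 := by
  have hl : 0 < Real.log 2 := Real.log_pos one_lt_two
  rcases hr.eq_or_lt with rfl | hr
  · simp only [zero_mul, sub_zero]
    positivity
  have hQ' : 0 < Q := hQ.lt_of_ne fun h0 => hr.ne' (h h0.symm)
  have key := Real.log_le_sub_one_of_pos (div_pos hQ' hr)
  rw [Real.log_div hQ'.ne' hr.ne'] at key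
  have : r * (Real.log Q - Real.log r) ≤ Q - r := by
    calc r * (Real.log Q - Real.log r) ≤ r * (Q / r - 1) := by gcongr
      _ = Q - r := by field_simp
  rw [Real.logb, Real.logb]
  calc r * (Real.log Q / Real.log 2) - r * (Real.log r / Real.log 2)
      = (r * (Real.log Q - Real.log r)) / Real.log 2 := by ring
    _ ≤ _ := by gcongr

/-- Let `Y` have law `w` and let `X` given `Y = y` have law `Q x * G x y`, so that `G` is the
likelihood ratio with respect to a reference distribution `Q`. Then `I(X;Y)` is at most the average
of `G lg G` under the product of `Q` and `w`: the reference distribution can only increase the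
relative entropy whose minimum is the mutual information. -/
lemma mutualInformation_le_of_likelihood {α β : Type*} [Fintype α] [Fintype β]
    (w : β → ℝ) (Q : α → ℝ) (G : α → β → ℝ) (hw : ∀ y, 0 ≤ w y) (hw1 : ∑ y, w y = 1)
    (hQ : ∀ x, 0 ≤ Q x) (hQ1 : ∑ x, Q x = 1) (hG : ∀ x y, 0 ≤ G x y)
    (hG1 : ∀ y, ∑ x, Q x * G x y = 1) :
    mutualInformation (fun x y => w y * (Q x * G x y)) ≤
      ∑ x, Q x * ∑ y, w y * (G x y * Real.logb 2 (G x y)) := by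
  set r : α → ℝ := fun x => ∑ y, w y * (Q x * G x y) with hr
  have hr0 : ∀ x, 0 ≤ r x := fun x =>
    Finset.sum_nonneg fun y _ => mul_nonneg (hw y) (mul_nonneg (hQ x) (hG x y))
  have hsum : ∀ y, ∑ x, w y * (Q x * G x y) = w y := fun y => by
    rw [← Finset.mul_sum, hG1, mul_one]
  have hr1 : ∑ x, r x = 1 := by
    rw [hr, Finset.sum_comm]
    simp only [hsum, hw1]
  have hgibbs : ∑ x, r x * Real.logb 2 (Q x) - ∑ x, r x * Real.logb 2 (r x) ≤ 0 := by
    rw [← Finset.sum_sub_distrib]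
    calc _ ≤ ∑ x, (Q x - r x) / Real.log 2 := by
          refine Finset.sum_le_sum fun x _ => mul_logb_sub_mul_logb_le (hr0 x) (hQ x) fun h => ?_
          simp [hr, h]
      _ = 0 := by rw [← Finset.sum_div, Finset.sum_sub_distrib, hQ1, hr1, sub_self, zero_div]
  have hsplit : ∀ x y, Q x * G x y * Real.logb 2 (Q x * G x y) =
      Q x * G x y * Real.logb 2 (Q x) + Q x * (G x y * Real.logb 2 (G x y)) := by
    intro x y
    rcases eq_or_ne (Q x) 0 with h | h
    · simp [h]
    rcases eq_or_ne (G x y) 0 with h' | h'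
    · simp [h']
    rw [Real.logb_mul h h']
    ring
  have hcond : conditionalEntropy (fun x y => w y * (Q x * G x y)) =
      -∑ x, ∑ y, w y * (Q x * G x y * Real.logb 2 (Q x * G x y)) := by
    rw [conditionalEntropy, Finset.sum_comm, ← Finset.sum_neg_distrib]
    refine Finset.sum_congr rfl fun y _ => ?_
    rw [hsum]
    rcases eq_or_ne (w y) 0 with h | h
    · simp [h]
    simp only [mul_div_cancel_left₀ _ h, shannonEntropy, ← Finset.mul_sum, mul_neg]
  have hexp : ∑ x, ∑ y, w y * (Q x * G x y * Real.logb 2 (Q x * G x y)) =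
      ∑ x, r x * Real.logb 2 (Q x) +
        ∑ x, Q x * ∑ y, w y * (G x y * Real.logb 2 (G x y)) := by
    rw [← Finset.sum_add_distrib]
    refine Finset.sum_congr rfl fun x _ => ?_
    rw [hr, Finset.sum_mul, Finset.mul_sum, ← Finset.sum_add_distrib]
    refine Finset.sum_congr rfl fun y _ => ?_
    rw [hsplit]
    ring
  rw [mutualInformation, hcond, hexp, shannonEntropy]
  change -∑ x, r x * Real.logb 2 (r x) - _ ≤ _
  linarith

/-! ### Outcome probabilities of adaptive strategies -/

/-- Adaptively chosen conditional distributions compose to a distribution on outcome strings. -/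
lemma sum_prod_before {q : ℕ} : ∀ {n : ℕ} (h : (a : Fin n) → (Fin (a : ℕ) → Fin q) → Fin q → ℝ),
    (∀ a w, ∑ ζ, h a w ζ = 1) → ∑ z : Fin n → Fin q, ∏ a, h a (before z a) (z a) = 1
  | 0, _, _ => by simp
  | n + 1, h, hh => by
    rw [← (Fin.snocEquiv fun _ : Fin (n + 1) => Fin q).sum_comp, Fintype.sum_prod_type_right]
    have hlast : ∀ (z : Fin n → Fin q) (ζ : Fin q),
        before (Fin.snoc (α := fun _ => Fin q) z ζ) (Fin.last n) = z := fun z ζ => by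
      funext i
      exact Fin.snoc_castSucc (α := fun _ => Fin q) ζ z i
    have hcast : ∀ (z : Fin n → Fin q) (ζ : Fin q) (a : Fin n),
        before (Fin.snoc (α := fun _ => Fin q) z ζ) a.castSucc = before z a := fun z ζ a => by
      funext i
      exact Fin.snoc_castSucc (α := fun _ => Fin q) ζ z ⟨i, i.isLt.trans a.isLt⟩
    change ∑ z, ∑ ζ, ∏ a, h a (before (Fin.snoc (α := fun _ => Fin q) z ζ) a)
      (Fin.snoc (α := fun _ => Fin q) z ζ a) = 1
    simp only [Fin.prod_univ_castSucc, Fin.snoc_castSucc, Fin.snoc_last, hlast, hcast,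
      ← Finset.mul_sum]
    calc _ = ∑ z : Fin n → Fin q, ∏ a : Fin n, h a.castSucc (before z a) (z a) :=
          Finset.sum_congr rfl fun z _ => by rw [hh, mul_one]
      _ = 1 := sum_prod_before (fun a w ζ => h a.castSucc w ζ) fun a w => hh a.castSucc w

/-- The relative probabilities `2 ⟨α_y| ρ |α_y⟩` of a qubit density matrix `ρ` in the four states
`α_y`. They only depend on the components `v.1 = tr (ρ σ_Z)` and `v.2 = tr (ρ σ_X)` of the Bloch
vector of `ρ`. -/
def response (v : ℝ × ℝ) : Bool × Bool → ℝ
  | (false, false) => 1 + v.1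
  | (true, true) => 1 - v.1
  | (false, true) => 1 + v.2
  | (true, false) => 1 - v.2

/-- The `Z` and `X` components of the Bloch vector of the density matrix `M / tr M`
(zero if `tr M = 0`). -/
noncomputable def blochVec (M : Matrix (Fin 2) (Fin 2) ℂ) : ℝ × ℝ :=
  (((M 0 0).re - (M 1 1).re) / M.trace.re, 2 * (M 0 1).re / M.trace.re)

/-- The likelihood ratio `∏ᵢ 2 ⟨α_{yᵢ}| ρᵢ |α_{yᵢ}⟩` of a product of qubit density matrices with
Bloch vectors `v i`. -/
def likelihood {n : ℕ} (v : Fin n → ℝ × ℝ) (y : Fin n → Bool × Bool) : ℝ :=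
  ∏ i, response (v i) (y i)

lemma posSemidef_fin_two {M : Matrix (Fin 2) (Fin 2) ℂ} (hM : M.PosSemidef) :
    0 ≤ (M 0 0).re ∧ 0 ≤ (M 1 1).re ∧ (M 0 0).im = 0 ∧ (M 1 1).im = 0 ∧
      M 1 0 = star (M 0 1) ∧
      (M 0 1).re ^ 2 + (M 0 1).im ^ 2 ≤ (M 0 0).re * (M 1 1).re := by
  have h0 := Complex.le_def.1 (hM.diag_nonneg (i := 0))
  have h1 := Complex.le_def.1 (hM.diag_nonneg (i := 1))
  have h10 : M 1 0 = star (M 0 1) := (hM.isHermitian.apply 1 0).symm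
  have hdet := (Complex.le_def.1 hM.det_nonneg).1
  rw [Matrix.det_fin_two, h10] at hdet
  simp only [Complex.zero_re, Complex.zero_im] at h0 h1 hdet
  simp [Complex.mul_re, ← h0.2, ← h1.2] at hdet
  exact ⟨h0.1, h1.1, h0.2.symm, h1.2.symm, h10, by nlinarith⟩

lemma blochVec_sq_le_one {M : Matrix (Fin 2) (Fin 2) ℂ} (hM : M.PosSemidef) :
    (blochVec M).1 ^ 2 + (blochVec M).2 ^ 2 ≤ 1 := by
  obtain ⟨h0, h1, -, -, -, hd⟩ := posSemidef_fin_two hM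
  rw [blochVec]
  simp only [div_pow, ← add_div, Matrix.trace_fin_two, Complex.add_re]
  refine div_le_one_of_le₀ ?_ (sq_nonneg _)
  nlinarith [sq_nonneg (M 0 1).im]

lemma trace_re_nonneg {M : Matrix (Fin 2) (Fin 2) ℂ} (hM : M.PosSemidef) : 0 ≤ M.trace.re := by
  obtain ⟨h0, h1, -⟩ := posSemidef_fin_two hM
  rw [Matrix.trace_fin_two, Complex.add_re]
  exact add_nonneg h0 h1

/-- The Born probability of a qubit POVM element in the state `α_y`. -/
lemma alpha_expectation {M : Matrix (Fin 2) (Fin 2) ℂ} (hM : M.PosSemidef) (y : Bool × Bool) :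
    ∑ s, ∑ t, star (alpha y s) * M s t * alpha y t =
      ((M.trace.re / 2 * response (blochVec M) y : ℝ) : ℂ) := by
  obtain ⟨h0, h1, i0, i1, h10, hd⟩ := posSemidef_fin_two hM
  have hs : (1 / (Real.sqrt 2 : ℂ)) * (1 / (Real.sqrt 2 : ℂ)) = 1 / 2 := by
    rw [div_mul_div_comm, one_mul, ← Complex.ofReal_mul, Real.mul_self_sqrt zero_le_two]
    norm_num
  have hc : (starRingEnd ℂ) (1 / (Real.sqrt 2 : ℂ)) = 1 / (Real.sqrt 2 : ℂ) := by
    rw [map_div₀, map_one, Complex.conj_ofReal]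
  -- Clearing the denominator of `blochVec` also covers `tr M = 0`, where `M = 0`.
  have hx : M.trace.re * (blochVec M).1 = (M 0 0).re - (M 1 1).re := by
    rw [blochVec]
    refine mul_div_cancel_of_imp' fun h => ?_
    rw [Matrix.trace_fin_two, Complex.add_re] at h
    linarith
  have hy : M.trace.re * (blochVec M).2 = 2 * (M 0 1).re := by
    rw [blochVec]
    refine mul_div_cancel_of_imp' fun h => ?_
    rw [Matrix.trace_fin_two, Complex.add_re] at h
    have h0' : (M 0 0).re = 0 := by linarith
    rw [h0', zero_mul] at hd
    nlinarith [sq_nonneg (M 0 1).re, sq_nonneg (M 0 1).im]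
  have ht : M.trace.re = (M 0 0).re + (M 1 1).re := by
    rw [Matrix.trace_fin_two, Complex.add_re]
  have e0 : M 0 0 = ((M 0 0).re : ℂ) := Complex.ext rfl (by simpa using i0)
  have e1 : M 1 1 = ((M 1 1).re : ℂ) := Complex.ext rfl (by simpa using i1)
  have e01 : M 0 1 + M 1 0 = ((2 * (M 0 1).re : ℝ) : ℂ) := by
    rw [h10]
    exact Complex.add_conj _
  have hxc : (M.trace.re : ℂ) * ((blochVec M).1 : ℂ) = M 0 0 - M 1 1 := by
    rw [e0, e1]
    exact_mod_cast hx
  have hyc : (M.trace.re : ℂ) * ((blochVec M).2 : ℂ) = M 0 1 + M 1 0 := by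
    rw [e01]
    exact_mod_cast hy
  have htc : (M.trace.re : ℂ) = M 0 0 + M 1 1 := by
    rw [e0, e1]
    exact_mod_cast ht
  rcases y with ⟨_ | _, _ | _⟩ <;>
    simp only [alpha, response, Fin.sum_univ_two, Matrix.cons_val_zero, Matrix.cons_val_one,
      RCLike.star_def, map_one, map_zero, map_neg, hc] <;> push_cast
  · linear_combination -(1 / 2) * hxc - (1 / 2) * htc
  · linear_combination (M 0 0 + M 0 1 + M 1 0 + M 1 1) * hs - (1 / 2) * hyc - (1 / 2) * htc
  · linear_combination (M 0 0 - M 0 1 - M 1 0 + M 1 1) * hs + (1 / 2) * hyc - (1 / 2) * htc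
  · linear_combination (1 / 2) * hxc - (1 / 2) * htc

lemma response_nonneg {v : ℝ × ℝ} (hv : v.1 ^ 2 + v.2 ^ 2 ≤ 1) (y : Bool × Bool) :
    0 ≤ response v y := by
  have h1 := abs_le.1 ((sq_le_one_iff_abs_le_one v.1).1 (by nlinarith [sq_nonneg v.2]))
  have h2 := abs_le.1 ((sq_le_one_iff_abs_le_one v.2).1 (by nlinarith [sq_nonneg v.1]))
  rcases y with ⟨_ | _, _ | _⟩ <;> simp only [response] <;> linarith

lemma response_le_two {v : ℝ × ℝ} (hv : v.1 ^ 2 + v.2 ^ 2 ≤ 1) (y : Bool × Bool) :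
    response v y ≤ 2 := by
  have h1 := abs_le.1 ((sq_le_one_iff_abs_le_one v.1).1 (by nlinarith [sq_nonneg v.2]))
  have h2 := abs_le.1 ((sq_le_one_iff_abs_le_one v.2).1 (by nlinarith [sq_nonneg v.1]))
  rcases y with ⟨_ | _, _ | _⟩ <;> simp only [response] <;> linarith

lemma likelihood_nonneg {n : ℕ} {v : Fin n → ℝ × ℝ} (hv : ∀ i, (v i).1 ^ 2 + (v i).2 ^ 2 ≤ 1)
    (y : Fin n → Bool × Bool) : 0 ≤ likelihood v y :=
  Finset.prod_nonneg fun i _ => response_nonneg (hv i) _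

lemma likelihood_le {n : ℕ} {v : Fin n → ℝ × ℝ} (hv : ∀ i, (v i).1 ^ 2 + (v i).2 ^ 2 ≤ 1)
    (y : Fin n → Bool × Bool) : likelihood v y ≤ 2 ^ n := by
  calc likelihood v y ≤ ∏ _i : Fin n, (2 : ℝ) :=
        Finset.prod_le_prod (fun i _ => response_nonneg (hv i) _) fun i _ =>
          response_le_two (hv i) _
    _ = 2 ^ n := by simp

namespace OnePassStrategy

variable {ν n q : ℕ} (S : OnePassStrategy n q)

/-- The element `M_a(z_{≤a})` of the POVM used at step `a`. -/
abbrev localElement (z : Fin n → Fin q) (a : Fin n) : Matrix (Fin 2) (Fin 2) ℂ :=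
  S.povm a (before z a) (z a)

/-- The probability `∏ₐ tr M_a(z_{≤a}) / 2` of the outcome string `z` in the maximally mixed
state. -/
noncomputable def mixedProb (z : Fin n → Fin q) : ℝ := ∏ a, (S.localElement z a).trace.re / 2

/-- The order in which the qubits are measured when the outcomes are `z`. -/
noncomputable def order (z : Fin n → Fin q) : Fin n ≃ Fin n :=
  Equiv.ofBijective _ (Finite.injective_iff_bijective.1 (S.qubit_injective z))

/-- The Bloch vectors of the qubit density matrices proportional to the tensor factors of `M(z)`,
indexed by the qubit measured. -/
noncomputable def blochVecs (z : Fin n → Fin q) (i : Fin n) : ℝ × ℝ :=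
  blochVec (S.localElement z ((S.order z).symm i))

lemma blochVecs_sq_le_one (z : Fin n → Fin q) (i : Fin n) :
    (S.blochVecs z i).1 ^ 2 + (S.blochVecs z i).2 ^ 2 ≤ 1 :=
  blochVec_sq_le_one (S.povm_posSemidef _ _ _)

lemma mixedProb_nonneg (z : Fin n → Fin q) : 0 ≤ S.mixedProb z :=
  Finset.prod_nonneg fun _ _ =>
    div_nonneg (trace_re_nonneg (S.povm_posSemidef _ _ _)) zero_le_two

lemma sum_mixedProb : ∑ z, S.mixedProb z = 1 := by
  refine sum_prod_before (fun a w ζ => (S.povm a w ζ).trace.re / 2) fun a w => ?_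
  rw [← Finset.sum_div, ← Complex.re_sum, ← Matrix.trace_sum, S.povm_sum, Matrix.trace_one]
  simp

lemma alpha_norm (y : Bool × Bool) :
    ∑ s, ∑ t, star (alpha y s) * (1 : Matrix (Fin 2) (Fin 2) ℂ) s t * alpha y t = 1 := by
  rw [alpha_expectation Matrix.PosSemidef.one]
  rcases y with ⟨_ | _, _ | _⟩ <;> simp [response, blochVec]

lemma mixedProb_mul_likelihood (z : Fin n → Fin q) (y : Fin n → Bool × Bool) :
    S.mixedProb z * likelihood (S.blochVecs z) y =
      ∏ a, (S.localElement z a).trace.re / 2 *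
        response (blochVec (S.localElement z a)) (y (S.qubit a (before z a))) := by
  rw [mixedProb, likelihood, ← (S.order z).prod_comp fun i => response (S.blochVecs z i) (y i),
    ← Finset.prod_mul_distrib]
  refine Finset.prod_congr rfl fun a _ => ?_
  rw [blochVecs, Equiv.symm_apply_apply]
  rfl

/-- For each product state the outcome probabilities sum to one. -/
lemma sum_mixedProb_mul_likelihood (y : Fin n → Bool × Bool) :
    ∑ z, S.mixedProb z * likelihood (S.blochVecs z) y = 1 := by
  simp only [S.mixedProb_mul_likelihood]
  refine sum_prod_before (fun a w ζ => (S.povm a w ζ).trace.re / 2 *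
    response (blochVec (S.povm a w ζ)) (y (S.qubit a w))) fun a w => ?_
  apply Complex.ofReal_injective
  rw [Complex.ofReal_sum, Complex.ofReal_one, ← alpha_norm (y (S.qubit a w)), ← S.povm_sum a w]
  simp only [← alpha_expectation (S.povm_posSemidef a w _), Matrix.sum_apply, Finset.mul_sum,
    Finset.sum_mul]
  rw [Finset.sum_comm]
  exact Finset.sum_congr rfl fun s _ => Finset.sum_comm

/-- The Born rule for a product measurement on a product state factorises over the qubits. -/
lemma outcomeProb_dataHidingState (E : Encoding ν n) (u : Fin ν → Bool) (z : Fin n → Fin q) :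
    S.outcomeProb (dataHidingState E u) z =
      S.mixedProb z * likelihood (S.blochVecs z) (E u) := by
  have hM : ∀ x y, S.element z x y =
      ∏ i, S.localElement z ((S.order z).symm i) (x i) (y i) := fun x y => by
    rw [← (S.order z).prod_comp]
    simp only [Equiv.symm_apply_apply]
    rfl
  have hprod : star (dataHidingState E u) ⬝ᵥ (S.element z).mulVec (dataHidingState E u) =
      ∏ i, ∑ s, ∑ t, star (alpha (E u i) s) * S.localElement z ((S.order z).symm i) s t *
        alpha (E u i) t := by
    simp only [Finset.prod_univ_sum, Fintype.piFinset_univ]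
    simp only [dotProduct, Matrix.mulVec, Finset.mul_sum, hM, dataHidingState, tensorVec,
      Pi.star_apply, star_prod, ← Finset.prod_mul_distrib, mul_assoc]
  have hreal : ∏ i, ∑ s, ∑ t, star (alpha (E u i) s) *
      S.localElement z ((S.order z).symm i) s t * alpha (E u i) t =
        ((S.mixedProb z * likelihood (S.blochVecs z) (E u) : ℝ) : ℂ) := by
    rw [mixedProb, likelihood, ← (S.order z).symm.prod_comp fun a => _ / 2,
      ← Finset.prod_mul_distrib, Complex.ofReal_prod]
    exact Finset.prod_congr rfl fun i _ => alpha_expectation (S.povm_posSemidef _ _ _) _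
  rw [outcomeProb, hprod, hreal, Complex.ofReal_re]

/-- The information gained is at most the average of `G lg G`, where `G` is the likelihood ratio
with respect to the maximally mixed state. -/
lemma gameInfo_le (E : Encoding ν n) :
    S.gameInfo E ≤ ∑ z, S.mixedProb z * ∑ u, 1 / 2 ^ ν *
      (likelihood (S.blochVecs z) (E u) * Real.logb 2 (likelihood (S.blochVecs z) (E u))) := by
  have h : S.gameDist E = fun z u =>
      1 / 2 ^ ν * (S.mixedProb z * likelihood (S.blochVecs z) (E u)) := by
    funext z u
    rw [gameDist, outcomeProb_dataHidingState]
  rw [gameInfo, h]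
  exact mutualInformation_le_of_likelihood (fun _ => 1 / 2 ^ ν) S.mixedProb
    (fun z u => likelihood (S.blochVecs z) (E u)) (fun _ => by positivity) (by simp)
    S.mixedProb_nonneg S.sum_mixedProb
    (fun z u => likelihood_nonneg (S.blochVecs_sq_le_one z) (E u))
    (fun u => S.sum_mixedProb_mul_likelihood (E u))

end OnePassStrategy

/-! ### A lower-tail bound for independent nonnegative variables -/

lemma exp_neg_le_quadratic {x : ℝ} (hx : 0 ≤ x) : Real.exp (-x) ≤ 1 - x + x ^ 2 / 2 := by
  have h := Real.quadratic_le_exp_of_nonneg hx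
  rw [Real.exp_neg]
  refine inv_le_of_inv_le₀ (by nlinarith [sq_nonneg (x - 1)]) (le_trans ?_ h)
  rw [inv_le_iff_one_le_mul₀ (by nlinarith [sq_nonneg (x - 1)])]
  nlinarith [sq_nonneg (x ^ 2)]

lemma integral_uniformOn_univ {β : Type*} [Fintype β] [Nonempty β] [MeasurableSpace β]
    [MeasurableSingletonClass β] (f : β → ℝ) :
    ∫ y, f y ∂(uniformOn (Set.univ : Set β)) = (∑ y, f y) / Fintype.card β := by
  rw [integral_fintype .of_finite, Finset.sum_div]
  refine Finset.sum_congr rfl fun y _ => ?_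
  rw [Measure.real, uniformOn_univ, Measure.count_singleton]
  simp [div_eq_inv_mul]

/-- Lower-tail Chernoff bound for the average of independent copies of a nonnegative function `f`
with mean at least `m` and second moment at most `v`. As `f` is nonnegative, no upper bound on its
values enters. -/
lemma measureReal_average_le {U β : Type*} [Fintype U] [Nonempty U] [Fintype β] [Nonempty β]
    [MeasurableSpace β] [MeasurableSingletonClass β] {f : β → ℝ} {m v t : ℝ} (hf : ∀ y, 0 ≤ f y)
    (hm : Fintype.card β * m ≤ ∑ y, f y) (hv : ∑ y, f y ^ 2 ≤ Fintype.card β * v)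
    (hv0 : 0 < v) (ht : 0 ≤ t) :
    (Measure.pi fun _ : U => uniformOn (Set.univ : Set β)).real
        {E | (∑ u, f (E u)) / Fintype.card U ≤ m - t} ≤
      Real.exp (-(Fintype.card U * t ^ 2 / (2 * v))) := by
  set μ := Measure.pi fun _ : U => uniformOn (Set.univ : Set β)
  have hU : (0 : ℝ) < Fintype.card U := by exact_mod_cast Fintype.card_pos
  have hβ : (0 : ℝ) < Fintype.card β := by exact_mod_cast Fintype.card_pos
  -- The exponent that optimises the bound.
  set l := t / v with hl
  have hl0 : 0 ≤ l := by positivity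
  have hset : {E : U → β | (∑ u, f (E u)) / Fintype.card U ≤ m - t} =
      {E | (∑ u, f (E u)) ≤ Fintype.card U * (m - t)} := by
    ext E
    simp only [Set.mem_ofPred_eq, div_le_iff₀' hU]
  have hone : ∫ y, Real.exp (-l * f y) ∂(uniformOn (Set.univ : Set β)) ≤
      Real.exp (-l * m + l ^ 2 * v / 2) := by
    rw [integral_uniformOn_univ, div_le_iff₀ hβ]
    calc ∑ y, Real.exp (-l * f y)
        ≤ ∑ y, (1 - l * f y + l ^ 2 / 2 * f y ^ 2) := by
          refine Finset.sum_le_sum fun y _ => ?_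
          have := exp_neg_le_quadratic (mul_nonneg hl0 (hf y))
          rw [neg_mul]
          linarith [mul_pow l (f y) 2]
      _ = Fintype.card β - l * ∑ y, f y + l ^ 2 / 2 * ∑ y, f y ^ 2 := by
          rw [Finset.sum_add_distrib, Finset.sum_sub_distrib, Finset.mul_sum, Finset.mul_sum]
          simp
      _ ≤ Fintype.card β - l * (Fintype.card β * m) + l ^ 2 / 2 * (Fintype.card β * v) := by
          gcongr
      _ = (-l * m + l ^ 2 * v / 2 + 1) * Fintype.card β := by ring
      _ ≤ Real.exp (-l * m + l ^ 2 * v / 2) * Fintype.card β := by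
          gcongr
          exact Real.add_one_le_exp _
  have hmgf : mgf (fun E : U → β => ∑ u, f (E u)) μ (-l) ≤
      Real.exp (-l * m + l ^ 2 * v / 2) ^ Fintype.card U := by
    simp only [mgf, Finset.mul_sum, Real.exp_sum]
    rw [integral_fintype_prod_eq_prod (fun _ y => Real.exp (-l * f y)), Finset.prod_const,
      Finset.card_univ]
    exact pow_le_pow_left₀ (integral_nonneg fun _ => (Real.exp_pos _).le) hone _
  rw [hset]
  refine (measure_le_le_exp_mul_mgf _ (neg_nonpos.2 hl0) .of_finite).trans ?_
  refine (mul_le_mul_of_nonneg_left hmgf (Real.exp_pos _).le).trans_eq ?_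
  rw [← Real.exp_nat_mul, ← Real.exp_add]
  congr 1
  rw [hl]
  field_simp
  ring

/-! ### Moments and continuity of the likelihood ratio -/

lemma sum_likelihood {n : ℕ} (v : Fin n → ℝ × ℝ) : ∑ y, likelihood v y = 4 ^ n := by
  have h := Finset.prod_univ_sum (fun _ : Fin n => (Finset.univ : Finset (Bool × Bool)))
    fun i y => response (v i) y
  rw [Fintype.piFinset_univ] at h
  simp only [likelihood, ← h]
  have h4 : ∀ i, ∑ y, response (v i) y = 4 := fun i => by
    simp only [Fintype.sum_prod_type, Fintype.sum_bool, response]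
    ring
  simp [h4]

lemma sum_likelihood_sq_le {n : ℕ} {v : Fin n → ℝ × ℝ}
    (hv : ∀ i, (v i).1 ^ 2 + (v i).2 ^ 2 ≤ 1) : ∑ y, likelihood v y ^ 2 ≤ 6 ^ n := by
  have h := Finset.prod_univ_sum (fun _ : Fin n => (Finset.univ : Finset (Bool × Bool)))
    fun i y => response (v i) y ^ 2
  rw [Fintype.piFinset_univ] at h
  simp only [likelihood, ← Finset.prod_pow, ← h]
  calc _ ≤ ∏ _i : Fin n, (6 : ℝ) := by
        refine Finset.prod_le_prod (fun i _ => Finset.sum_nonneg fun _ _ => sq_nonneg _)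
          fun i _ => ?_
        simp only [Fintype.sum_prod_type, Fintype.sum_bool, response]
        linarith [hv i]
    _ = 6 ^ n := by simp

lemma abs_prod_sub_prod_le {ε : ℝ} (hε : 0 ≤ ε) : ∀ {n : ℕ} {a b : Fin n → ℝ},
    (∀ i, |a i| ≤ 2) → (∀ i, |b i| ≤ 2) → (∀ i, |a i - b i| ≤ ε) →
      |∏ i, a i - ∏ i, b i| ≤ n * 2 ^ n * ε
  | 0, _, _, _, _, _ => by simp
  | n + 1, a, b, ha, hb, hab => by
    have ih := abs_prod_sub_prod_le hε (fun i => ha i.succ) (fun i => hb i.succ)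
      fun i => hab i.succ
    have hB : |∏ i : Fin n, b i.succ| ≤ 2 ^ n := by
      rw [Finset.abs_prod]
      exact (Finset.prod_le_prod (fun i _ => abs_nonneg _) fun i _ => hb i.succ).trans_eq
        (by simp)
    rw [Fin.prod_univ_succ, Fin.prod_univ_succ]
    calc |a 0 * ∏ i : Fin n, a i.succ - b 0 * ∏ i : Fin n, b i.succ|
        = |a 0 * (∏ i : Fin n, a i.succ - ∏ i : Fin n, b i.succ) +
            (a 0 - b 0) * ∏ i : Fin n, b i.succ| := by ring_nf
      _ ≤ |a 0| * |∏ i : Fin n, a i.succ - ∏ i : Fin n, b i.succ| +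
            |a 0 - b 0| * |∏ i : Fin n, b i.succ| := by
          rw [← abs_mul, ← abs_mul]
          exact abs_add_le _ _
      _ ≤ 2 * (n * 2 ^ n * ε) + ε * 2 ^ n := by
          gcongr
          exacts [ha 0, hab 0]
      _ ≤ ((n + 1 : ℕ) : ℝ) * 2 ^ (n + 1) * ε := by
          push_cast
          rw [pow_succ]
          nlinarith [mul_nonneg (pow_nonneg zero_le_two n : (0 : ℝ) ≤ 2 ^ n) hε]

lemma abs_likelihood_sub_le {n : ℕ} {v w : Fin n → ℝ × ℝ} {ε : ℝ} (hε : 0 ≤ ε)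
    (hv : ∀ i, (v i).1 ^ 2 + (v i).2 ^ 2 ≤ 1) (hw : ∀ i, (w i).1 ^ 2 + (w i).2 ^ 2 ≤ 1)
    (hvw : ∀ i, |(v i).1 - (w i).1| ≤ ε ∧ |(v i).2 - (w i).2| ≤ ε) (y : Fin n → Bool × Bool) :
    |likelihood v y - likelihood w y| ≤ n * 2 ^ n * ε := by
  have h : ∀ {v : Fin n → ℝ × ℝ}, (∀ i, (v i).1 ^ 2 + (v i).2 ^ 2 ≤ 1) →
      ∀ i, |response (v i) (y i)| ≤ 2 := fun hv i => by
    rw [abs_of_nonneg (response_nonneg (hv i) _)]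
    exact response_le_two (hv i) _
  refine abs_prod_sub_prod_le hε (h hv) (h hw) fun i => ?_
  obtain ⟨h1, h2⟩ := hvw i
  rw [abs_le] at h1 h2 ⊢
  rcases y i with ⟨_ | _, _ | _⟩ <;> simp only [response] <;> constructor <;> linarith

/-- Truncating the likelihood ratio at the level `K` decreases its mean by at most
`E[G²] / (4 K)`. -/
lemma sum_min_likelihood_ge {n : ℕ} {v : Fin n → ℝ × ℝ} {K : ℝ} (hK : 0 < K)
    (hv : ∀ i, (v i).1 ^ 2 + (v i).2 ^ 2 ≤ 1) :
    4 ^ n - 6 ^ n / (4 * K) ≤ ∑ y, min (likelihood v y) K := by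
  have h : ∀ y, likelihood v y - likelihood v y ^ 2 / (4 * K) ≤ min (likelihood v y) K := by
    intro y
    refine le_min (sub_le_self _ (by positivity)) ?_
    rw [sub_le_iff_le_add, ← sub_le_iff_le_add', le_div_iff₀ (by positivity)]
    nlinarith [sq_nonneg (likelihood v y - 2 * K)]
  calc 4 ^ n - 6 ^ n / (4 * K)
      ≤ ∑ y, likelihood v y - (∑ y, likelihood v y ^ 2) / (4 * K) := by
        rw [sum_likelihood]
        gcongr
        exact sum_likelihood_sq_le hv
    _ = ∑ y, (likelihood v y - likelihood v y ^ 2 / (4 * K)) := by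
        rw [Finset.sum_sub_distrib, Finset.sum_div]
    _ ≤ _ := Finset.sum_le_sum fun y _ => h y

/-! ### Uniform concentration over all product measurements -/

/-- Rounding towards zero to a multiple of `1 / m`. -/
lemma exists_grid_point {m : ℕ} (hm : 0 < m) {x : ℝ} (hx : |x| ≤ 1) :
    ∃ k : Set.Icc (-(m : ℤ)) m, |(k : ℤ) / (m : ℝ)| ≤ |x| ∧ |x - (k : ℤ) / (m : ℝ)| ≤ 1 / m := by
  have hm' : (0 : ℝ) < m := by exact_mod_cast hm
  have key : ∀ x : ℝ, 0 ≤ x → x ≤ 1 → ∃ k : ℤ, 0 ≤ k ∧ k ≤ m ∧ (k : ℝ) / m ≤ x ∧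
      x - k / m ≤ 1 / m := by
    intro x hx0 hx1
    refine ⟨⌊x * m⌋, Int.floor_nonneg.2 (by positivity), ?_, ?_, ?_⟩
    · have : (⌊x * m⌋ : ℝ) ≤ m := (Int.floor_le _).trans (mul_le_of_le_one_left hm'.le hx1)
      exact_mod_cast this
    · rw [div_le_iff₀ hm']
      exact Int.floor_le _
    · rw [sub_le_iff_le_add, ← add_div, le_div_iff₀ hm']
      linarith [Int.lt_floor_add_one (x * m)]
  obtain ⟨k, hk0, hkm, h1, h2⟩ := key |x| (abs_nonneg x) hx
  have hk : (0 : ℝ) ≤ (k : ℝ) / m := div_nonneg (by exact_mod_cast hk0) hm'.le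
  rcases le_total 0 x with h | h
  · refine ⟨⟨k, by omega, hkm⟩, ?_, ?_⟩
    · rwa [abs_of_nonneg hk]
    · rw [abs_of_nonneg h] at h1 h2
      rwa [abs_of_nonneg (sub_nonneg.2 h1)]
  · refine ⟨⟨-k, by omega, by omega⟩, ?_, ?_⟩
    · simp only [Int.cast_neg, neg_div, abs_neg]
      rwa [abs_of_nonneg hk]
    · rw [abs_of_nonpos h] at h1 h2
      simp only [Int.cast_neg, neg_div, sub_neg_eq_add]
      rw [abs_of_nonpos (by linarith)]
      linarith

/-- The vector of Bloch vectors given by a point of the grid of mesh `1 / m`. -/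
noncomputable def gridVec {n : ℕ} (m : ℕ)
    (k : Fin n → Set.Icc (-(m : ℤ)) m × Set.Icc (-(m : ℤ)) m) (i : Fin n) : ℝ × ℝ :=
  (((k i).1 : ℤ) / (m : ℝ), ((k i).2 : ℤ) / (m : ℝ))

lemma exists_gridVec {n m : ℕ} (hm : 0 < m) {v : Fin n → ℝ × ℝ}
    (hv : ∀ i, (v i).1 ^ 2 + (v i).2 ^ 2 ≤ 1) :
    ∃ k, (∀ i, (gridVec m k i).1 ^ 2 + (gridVec m k i).2 ^ 2 ≤ 1) ∧
      ∀ i, |(v i).1 - (gridVec m k i).1| ≤ 1 / m ∧ |(v i).2 - (gridVec m k i).2| ≤ 1 / m := by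
  have h1 : ∀ i, |(v i).1| ≤ 1 := fun i =>
    (sq_le_one_iff_abs_le_one _).1 (by nlinarith [hv i, sq_nonneg (v i).2])
  have h2 : ∀ i, |(v i).2| ≤ 1 := fun i =>
    (sq_le_one_iff_abs_le_one _).1 (by nlinarith [hv i, sq_nonneg (v i).1])
  choose k hk hk' using fun i => exists_grid_point hm (h1 i)
  choose l hl hl' using fun i => exists_grid_point hm (h2 i)
  exact ⟨fun i => (k i, l i), fun i => (add_le_add (sq_le_sq.2 (hk i)) (sq_le_sq.2 (hl i))).trans
    (hv i), fun i => ⟨hk' i, hl' i⟩⟩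

/-- The average over the code words of the likelihood ratio truncated at the level `K`. -/
noncomputable def truncatedMass {ν n : ℕ} (E : Encoding ν n) (K : ℝ) (v : Fin n → ℝ × ℝ) : ℝ :=
  (∑ u, min (likelihood v (E u)) K) / 2 ^ ν

lemma truncatedMass_le_add {ν n : ℕ} (E : Encoding ν n) (K : ℝ) {v w : Fin n → ℝ × ℝ} {ε : ℝ}
    (hε : 0 ≤ ε) (hv : ∀ i, (v i).1 ^ 2 + (v i).2 ^ 2 ≤ 1)
    (hw : ∀ i, (w i).1 ^ 2 + (w i).2 ^ 2 ≤ 1)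
    (hvw : ∀ i, |(v i).1 - (w i).1| ≤ ε ∧ |(v i).2 - (w i).2| ≤ ε) :
    truncatedMass E K w ≤ truncatedMass E K v + n * 2 ^ n * ε := by
  have h : ∀ u, min (likelihood w (E u)) K ≤ min (likelihood v (E u)) K + n * 2 ^ n * ε := by
    intro u
    have := abs_le.1 (abs_likelihood_sub_le hε hv hw hvw (E u))
    rw [← sub_le_iff_le_add]
    refine le_min ?_ ?_
    · linarith [min_le_left (likelihood w (E u)) K]
    · linarith [min_le_right (likelihood w (E u)) K,
        show 0 ≤ n * 2 ^ n * ε by positivity]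
  rw [truncatedMass, truncatedMass, div_add' _ _ _ (by positivity)]
  gcongr
  calc _ ≤ ∑ u, (min (likelihood v (E u)) K + n * 2 ^ n * ε) :=
        Finset.sum_le_sum fun u _ => h u
    _ = _ := by
        rw [Finset.sum_add_distrib]
        simp
        ring

/-- For a fixed product measurement operator, the truncated mass is close to one except with doubly
exponentially small probability. -/
lemma measureReal_truncatedMass_le {ν n : ℕ} {K t : ℝ} (hK : 0 < K) (ht : 0 ≤ t)
    {v : Fin n → ℝ × ℝ} (hv : ∀ i, (v i).1 ^ 2 + (v i).2 ^ 2 ≤ 1) :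
    (randomEncoding ν n).real
        {E | truncatedMass E K v ≤ 1 - (3 / 2) ^ n / (4 * K) - t} ≤
      Real.exp (-(2 ^ ν * t ^ 2 / (2 * (3 / 2) ^ n))) := by
  have hmin : ∀ y, 0 ≤ min (likelihood v y) K := fun y => le_min (likelihood_nonneg hv y) hK.le
  have h46 : (4 : ℝ) ^ n * (3 / 2) ^ n = 6 ^ n := by
    rw [← mul_pow]
    norm_num
  have h := measureReal_average_le (U := Fin ν → Bool) (m := 1 - (3 / 2) ^ n / (4 * K))
    (v := (3 / 2) ^ n) (t := t) hmin ?_ ?_ (by positivity) ht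
  · simpa [randomEncoding, truncatedMass] using h
  · have := sum_min_likelihood_ge hK hv
    rw [← h46] at this
    simp only [Fintype.card_pi, Fintype.card_prod, Fintype.card_bool, Finset.prod_const,
      Finset.card_univ, Fintype.card_fin]
    push_cast
    norm_num
    convert this using 1
    ring
  · simp only [Fintype.card_pi, Fintype.card_prod, Fintype.card_bool, Finset.prod_const,
      Finset.card_univ, Fintype.card_fin]
    push_cast
    norm_num
    rw [h46]
    refine le_trans (Finset.sum_le_sum fun y _ => ?_) (sum_likelihood_sq_le hv)
    exact pow_le_pow_left₀ (hmin y) (min_le_left _ _) 2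

/-- Union bound over the grid: with high probability the truncated mass is close to one for all
product measurement operators at once. -/
lemma measureReal_exists_truncatedMass_lt {ν n m : ℕ} (hm : 0 < m) {K t : ℝ} (hK : 0 < K)
    (ht : 0 ≤ t) :
    (randomEncoding ν n).real
        {E | ∃ v : Fin n → ℝ × ℝ, (∀ i, (v i).1 ^ 2 + (v i).2 ^ 2 ≤ 1) ∧
          truncatedMass E K v < 1 - (3 / 2) ^ n / (4 * K) - t - n * 2 ^ n * (1 / m)} ≤
      ((2 * m + 1) ^ 2) ^ n * Real.exp (-(2 ^ ν * t ^ 2 / (2 * (3 / 2) ^ n))) := by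
  have : IsProbabilityMeasure (randomEncoding ν n) := by
    unfold randomEncoding
    infer_instance
  have hsub : {E : Encoding ν n | ∃ v : Fin n → ℝ × ℝ, (∀ i, (v i).1 ^ 2 + (v i).2 ^ 2 ≤ 1) ∧
      truncatedMass E K v < 1 - (3 / 2) ^ n / (4 * K) - t - n * 2 ^ n * (1 / m)} ⊆
      ⋃ k : Fin n → Set.Icc (-(m : ℤ)) m × Set.Icc (-(m : ℤ)) m,
        {E | (∀ i, (gridVec m k i).1 ^ 2 + (gridVec m k i).2 ^ 2 ≤ 1) ∧
          truncatedMass E K (gridVec m k) ≤ 1 - (3 / 2) ^ n / (4 * K) - t} := by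
    rintro E ⟨v, hv, hlt⟩
    obtain ⟨k, hk, hvk⟩ := exists_gridVec hm hv
    have := truncatedMass_le_add E K (by positivity) hv hk hvk
    exact Set.mem_iUnion.2 ⟨k, hk, by linarith⟩
  refine (measureReal_mono hsub).trans ((measureReal_iUnion_fintype_le _).trans ?_)
  calc _ ≤ ∑ _k : Fin n → Set.Icc (-(m : ℤ)) m × Set.Icc (-(m : ℤ)) m,
        Real.exp (-(2 ^ ν * t ^ 2 / (2 * (3 / 2) ^ n))) := by
        refine Finset.sum_le_sum fun k _ => ?_
        by_cases hk : ∀ i, (gridVec m k i).1 ^ 2 + (gridVec m k i).2 ^ 2 ≤ 1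
        · exact (measureReal_mono fun E hE => hE.2).trans (measureReal_truncatedMass_le hK ht hk)
        · simp only [hk, false_and, Set.ofPred_false, measureReal_empty]
          positivity
    _ = _ := by
        have hcard : (((m : ℤ) + 1 + m).toNat : ℝ) = 2 * m + 1 := by
          have : ((m : ℤ) + 1 + m).toNat = 2 * m + 1 := by omega
          rw [this]
          push_cast
          ring
        simp [hcard, sq]

/-! ### From truncated mass to mutual information -/

/-- The logarithm of a likelihood ratio is at most `κ` for the part of `G` below the level
`K = 2 ^ κ`; only the excess over `K` pays the full price `d`. -/
lemma mul_logb_le_truncated {G κ d : ℝ} (hG : 0 ≤ G) (hd : G ≤ 2 ^ d) :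
    G * Real.logb 2 G ≤ κ * min G (2 ^ κ) + (d + 2) * (G - min G (2 ^ κ)) := by
  rcases hG.eq_or_lt with rfl | hG
  · rw [min_eq_left (by positivity)]
    simp
  set K : ℝ := 2 ^ κ with hK
  have hK0 : 0 < K := by positivity
  have hlogK : Real.logb 2 K = κ := Real.logb_rpow two_pos (by norm_num)
  rcases le_total G K with h | h
  · rw [min_eq_left h, sub_self, mul_zero, add_zero, mul_comm]
    gcongr
    rw [← hlogK]
    exact Real.logb_le_logb_of_le one_lt_two hG h
  · rw [min_eq_right h]
    have hGd : Real.logb 2 G ≤ d := (Real.logb_le_iff_le_rpow one_lt_two hG).2 hd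
    have hlog : Real.logb 2 G - κ ≤ 2 * (G / K - 1) := by
      rw [← hlogK, ← Real.logb_div hG.ne' hK0.ne', Real.logb,
        div_le_iff₀ (Real.log_pos one_lt_two)]
      have h1 := Real.log_le_sub_one_of_pos (div_pos hG hK0)
      have h2 : 0 ≤ G / K - 1 := sub_nonneg.2 ((one_le_div hK0).2 h)
      nlinarith [Real.log_two_gt_d9]
    have hmul : K * (Real.logb 2 G - κ) ≤ 2 * (G - K) := by
      calc _ ≤ K * (2 * (G / K - 1)) := by gcongr
        _ = _ := by field_simp
    nlinarith [mul_le_mul_of_nonneg_left hGd (sub_nonneg.2 h)]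

namespace OnePassStrategy

variable {ν n q : ℕ} (S : OnePassStrategy n q) (E : Encoding ν n)

/-- The average of the outcome distributions over the code words is a probability distribution. -/
lemma sum_mixedProb_mul_average :
    ∑ z, S.mixedProb z * ∑ u, 1 / 2 ^ ν * likelihood (S.blochVecs z) (E u) = 1 := by
  simp only [Finset.mul_sum, mul_left_comm _ (1 / 2 ^ ν : ℝ)]
  rw [Finset.sum_comm]
  simp only [← Finset.mul_sum, S.sum_mixedProb_mul_likelihood]
  simp

/-- The information gained is at most the number of qubits. -/
lemma gameInfo_le_card : S.gameInfo E ≤ n := by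
  refine (S.gameInfo_le E).trans ?_
  calc _ ≤ ∑ z, S.mixedProb z * ∑ u, 1 / 2 ^ ν * (likelihood (S.blochVecs z) (E u) * n) := by
        refine Finset.sum_le_sum fun z _ => mul_le_mul_of_nonneg_left
          (Finset.sum_le_sum fun u _ => mul_le_mul_of_nonneg_left ?_ (by positivity))
          (S.mixedProb_nonneg z)
        have h0 := likelihood_nonneg (S.blochVecs_sq_le_one z) (E u)
        rcases h0.eq_or_lt with h | h
        · simp [← h]
        refine mul_le_mul_of_nonneg_left ((Real.logb_le_iff_le_rpow one_lt_two h).2 ?_) h0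
        rw [Real.rpow_natCast]
        exact likelihood_le (S.blochVecs_sq_le_one z) (E u)
    _ = n * ∑ z, S.mixedProb z * ∑ u, 1 / 2 ^ ν * likelihood (S.blochVecs z) (E u) := by
        simp only [Finset.mul_sum]
        refine Finset.sum_congr rfl fun z _ => Finset.sum_congr rfl fun u _ => by ring
    _ = n := by rw [S.sum_mixedProb_mul_average, mul_one]

/-- If all product measurement operators have truncated mass at least `1 - δ`, the contribution of
likelihood ratios above `2 ^ κ` is at most `δ`, because the total mass is one. -/
lemma gameInfo_le_of_truncatedMass {κ δ : ℝ} (hκ : κ ≤ n + 2)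
    (h : ∀ v : Fin n → ℝ × ℝ, (∀ i, (v i).1 ^ 2 + (v i).2 ^ 2 ≤ 1) →
      1 - δ ≤ truncatedMass E (2 ^ κ) v) :
    S.gameInfo E ≤ κ + δ * (n + 2 - κ) := by
  refine (S.gameInfo_le E).trans ?_
  have hz : ∀ z, ∑ u, 1 / 2 ^ ν * (likelihood (S.blochVecs z) (E u) *
      Real.logb 2 (likelihood (S.blochVecs z) (E u))) ≤
      (n + 2) * ∑ u, 1 / 2 ^ ν * likelihood (S.blochVecs z) (E u) -
        (n + 2 - κ) * (1 - δ) := by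
    intro z
    have hv := S.blochVecs_sq_le_one z
    calc _ ≤ ∑ u, 1 / 2 ^ ν * (κ * min (likelihood (S.blochVecs z) (E u)) (2 ^ κ) + (n + 2) *
          (likelihood (S.blochVecs z) (E u) -
            min (likelihood (S.blochVecs z) (E u)) (2 ^ κ))) := by
          refine Finset.sum_le_sum fun u _ => mul_le_mul_of_nonneg_left
            (mul_logb_le_truncated (likelihood_nonneg hv _) ?_) (by positivity)
          rw [Real.rpow_natCast]
          exact likelihood_le hv _
      _ = (n + 2) * ∑ u, 1 / 2 ^ ν * likelihood (S.blochVecs z) (E u) -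
            (n + 2 - κ) * truncatedMass E (2 ^ κ) (S.blochVecs z) := by
          rw [truncatedMass, Finset.sum_div, Finset.mul_sum, Finset.mul_sum,
            ← Finset.sum_sub_distrib]
          refine Finset.sum_congr rfl fun u _ => by ring
      _ ≤ _ := by
          have : 0 ≤ n + 2 - κ := sub_nonneg.2 hκ
          gcongr
          exact h _ hv
  calc _ ≤ ∑ z, S.mixedProb z * ((n + 2) * ∑ u, 1 / 2 ^ ν * likelihood (S.blochVecs z) (E u) -
        (n + 2 - κ) * (1 - δ)) :=
        Finset.sum_le_sum fun z _ => mul_le_mul_of_nonneg_left (hz z) (S.mixedProb_nonneg z)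
    _ = (n + 2) * ∑ z, S.mixedProb z * ∑ u, 1 / 2 ^ ν * likelihood (S.blochVecs z) (E u) -
          (n + 2 - κ) * (1 - δ) * ∑ z, S.mixedProb z := by
        rw [Finset.mul_sum, Finset.mul_sum, ← Finset.sum_sub_distrib]
        refine Finset.sum_congr rfl fun z _ => by ring
    _ = κ + δ * (n + 2 - κ) := by
        rw [S.sum_mixedProb_mul_average, S.sum_mixedProb]
        ring

end OnePassStrategy

/-! ### Growth estimates -/

/-- The truncation level `2 ^ (0.7 n)` exceeds the second moment `(3 / 2) ^ n` of the likelihood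
ratio by an exponential factor. -/
lemma eventually_truncation_loss_le :
    ∀ᶠ n : ℕ in Filter.atTop, (3 / 2 : ℝ) ^ n / (4 * 2 ^ (0.7 * n : ℝ)) ≤ 0.01 := by
  have hlt : (3 / 2 : ℝ) < 2 ^ (0.7 : ℝ) := by
    refine lt_of_pow_lt_pow_left₀ 10 (by positivity) ?_
    rw [← Real.rpow_natCast (2 ^ (0.7 : ℝ)), ← Real.rpow_mul zero_le_two,
      show (0.7 : ℝ) * (10 : ℕ) = (7 : ℕ) by norm_num, Real.rpow_natCast]
    norm_num
  have hlim := tendsto_pow_atTop_nhds_zero_of_lt_one (r := (3 / 2 : ℝ) / 2 ^ (0.7 : ℝ))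
    (by positivity) ((div_lt_one (by positivity)).2 hlt)
  filter_upwards [hlim.eventually_le_const (show (0 : ℝ) < 0.04 by norm_num)] with n hn
  rw [Real.rpow_mul zero_le_two, Real.rpow_natCast]
  rw [div_pow] at hn
  calc _ = (3 / 2 : ℝ) ^ n / (2 ^ (0.7 : ℝ)) ^ n / 4 := by
        rw [div_div, mul_comm (4 : ℝ)]
    _ ≤ 0.04 / 4 := by gcongr
    _ = 0.01 := by norm_num

/-- The doubly exponentially small failure probability beats the size of the grid. -/
lemma eventually_union_bound_le (c : ℕ) :
    ∀ᶠ n : ℕ in Filter.atTop, ∀ ν : ℕ, n ≤ ν + c →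
      ((2 * (200 * n * 2 ^ n : ℕ) + 1) ^ 2) ^ n *
        Real.exp (-(2 ^ ν * 0.005 ^ 2 / (2 * (3 / 2) ^ n))) ≤ Real.exp (-(n : ℝ)) := by
  have hlim := tendsto_pow_const_div_const_pow_of_one_lt 2 (show (1 : ℝ) < 4 / 3 by norm_num)
  have hpos : (0 : ℝ) < 0.005 ^ 2 / (2 * 2 ^ c) / 23 := by positivity
  filter_upwards [hlim.eventually_le_const hpos, Filter.eventually_ge_atTop 1] with n hn hn1 ν hν
  have hn1' : (1 : ℝ) ≤ n := by exact_mod_cast hn1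
  have hexp : ∀ k : ℕ, (2 : ℝ) ^ k ≤ Real.exp k := fun k => by
    rw [← mul_one (k : ℝ), Real.exp_nat_mul]
    gcongr
    linarith [Real.add_one_le_exp 1]
  have hm : (2 * (200 * n * 2 ^ n : ℕ) + 1 : ℝ) ≤ Real.exp ((9 + 2 * n : ℕ) : ℝ) := by
    refine le_trans ?_ (hexp _)
    have h1 : n + 1 ≤ 2 ^ n := Nat.lt_two_pow_self
    have h2 : 2 * (200 * n * 2 ^ n) + 1 ≤ 2 ^ (9 + 2 * n) := by
      rw [pow_add, two_mul n, pow_add]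
      nlinarith
    exact_mod_cast h2
  have hgrid : ((2 * (200 * n * 2 ^ n : ℕ) + 1 : ℝ) ^ 2) ^ n ≤
      Real.exp (22 * (n : ℝ) ^ 2) := by
    rw [← pow_mul]
    calc _ ≤ Real.exp ((9 + 2 * n : ℕ) : ℝ) ^ (2 * n) := by gcongr
      _ = Real.exp ((2 * n : ℕ) * ((9 + 2 * n : ℕ) : ℝ)) := (Real.exp_nat_mul _ _).symm
      _ ≤ _ := by
        refine Real.exp_le_exp.2 ?_
        push_cast
        nlinarith
  have hν' : (2 : ℝ) ^ n / 2 ^ c ≤ 2 ^ ν := by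
    rw [div_le_iff₀ (by positivity), ← pow_add]
    exact pow_le_pow_right₀ one_le_two hν
  have hrate : 23 * (n : ℝ) ^ 2 ≤ 2 ^ ν * 0.005 ^ 2 / (2 * (3 / 2) ^ n) := by
    rw [div_le_iff₀ (by positivity)] at hn
    calc 23 * (n : ℝ) ^ 2 ≤ 23 * (0.005 ^ 2 / (2 * 2 ^ c) / 23 * (4 / 3) ^ n) := by gcongr
      _ = 2 ^ n / 2 ^ c * 0.005 ^ 2 / (2 * (3 / 2) ^ n) := by
        rw [show (4 / 3 : ℝ) = 2 / (3 / 2) by norm_num, div_pow]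
        field_simp
      _ ≤ _ := by gcongr
  calc _ ≤ Real.exp (22 * (n : ℝ) ^ 2) * Real.exp (-(23 * (n : ℝ) ^ 2)) := by gcongr
    _ = Real.exp (-(n : ℝ) ^ 2) := by
      rw [← Real.exp_add]
      ring_nf
    _ ≤ _ := by
      gcongr
      nlinarith

end IsolatedQubits

theorem mainTheorem3 (c : ℕ) :
    ∃ γ C₁ C₂ : ℝ, 0 < γ ∧
      ∀ n ν q : ℕ, 1 ≤ n → 1 ≤ q → ν ≤ n → n ≤ ν + c →
        1 - Real.exp (-γ * (n : ℝ)) ≤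
          (IsolatedQubits.randomEncoding ν n).real
            {E : IsolatedQubits.Encoding ν n |
              ∀ S : IsolatedQubits.OnePassStrategy n q,
                S.gameInfo E ≤
                  (0.7067 : ℝ) * (n : ℝ) + C₁ + C₂ * Real.logb 2 ((q : ℝ) * (n : ℝ))} := by
  open IsolatedQubits in
  obtain ⟨N, hN⟩ := Filter.eventually_atTop.1
    (eventually_truncation_loss_le.and (eventually_union_bound_le c))
  -- The grid argument is uniform in the number of outcomes, so no logarithmic term is needed;
  -- `C₁` covers the finitely many `n` to which the asymptotic estimates do not apply.
  refine ⟨1, N + 1, 0, one_pos, fun n ν q hn _ _ hν => ?_⟩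
  have : IsProbabilityMeasure (randomEncoding ν n) := by
    unfold randomEncoding
    infer_instance
  simp only [zero_mul, add_zero, neg_mul, one_mul]
  rcases le_total n N with hnN | hnN
  · have huniv : {E : Encoding ν n | ∀ S : OnePassStrategy n q,
        S.gameInfo E ≤ 0.7067 * n + (N + 1)} = Set.univ := by
      refine Set.eq_univ_of_forall fun E S => (S.gameInfo_le_card E).trans ?_
      have : (n : ℝ) ≤ N := by exact_mod_cast hnN
      linarith [(Nat.cast_nonneg n : (0 : ℝ) ≤ n)]
    rw [huniv, probReal_univ]
    linarith [Real.exp_pos (-(n : ℝ))]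
  obtain ⟨hloss, hunion⟩ := hN n hnN
  have hn' : (1 : ℝ) ≤ n := by exact_mod_cast hn
  -- This mesh moves each truncated mass by at most `0.005`.
  set m : ℕ := 200 * n * 2 ^ n with hm
  have hm0 : 0 < m := by positivity
  have hmesh : (n : ℝ) * 2 ^ n * (1 / m) = 0.005 := by
    rw [hm]
    push_cast
    field_simp
    norm_num
  have hbad := (measureReal_exists_truncatedMass_lt (ν := ν) (n := n) hm0
    (K := 2 ^ (0.7 * n : ℝ)) (t := 0.005) (by positivity) (by norm_num)).trans (hunion ν hν)
  set B : Set (Encoding ν n) := {E | ∃ v : Fin n → ℝ × ℝ, _} with hB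
  have hcompl : 1 - Real.exp (-(n : ℝ)) ≤ (randomEncoding ν n).real Bᶜ := by
    rw [probReal_compl_eq_one_sub (Set.toFinite B).measurableSet]
    linarith
  refine hcompl.trans (measureReal_mono fun E hE S => ?_)
  have hmass : ∀ v : Fin n → ℝ × ℝ, (∀ i, (v i).1 ^ 2 + (v i).2 ^ 2 ≤ 1) →
      1 - 0.02 ≤ truncatedMass E (2 ^ (0.7 * n : ℝ)) v := by
    intro v hv
    by_contra! hlt
    exact hE ⟨v, hv, by linarith⟩
  have := S.gameInfo_le_of_truncatedMass E (κ := 0.7 * n) (by linarith) hmass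
  linarith [(Nat.cast_nonneg N : (0 : ℝ) ≤ N)]
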